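/- **Theorem A.** Let $\mathsf A$ be an abelian category, let $(\mathsf X,\mathsf Y)$ be a complete cotorsion pair in $\mathsf A$, and let $Q$ be a quiver with vertex set $Q_0$. For a vertex $i$ let $Q_1^{*\to i}$ and $Q_1^{i\to *}$ be the sets of arrows with target $i$ and with source $i$, respectively, and let $s(a)$, $t(a)$ denote the source and target of an arrow $a$. Let $\mathrm{Rep}(Q,\mathsf A)$ be the abelian category of $\mathsf A$-valued representations of $Q$. (a) Suppose that $Q$ is left rooted and that $\mathsf A$ has exact $|Q_1^{*\to i}|$-indexed coproducts for every vertex $i$ of $Q$. Let $\Phi(\mathsf X)$ be the class of representations $F$ such that for every vertex $i$ the canonical morphism $\varphi_i^F:\bigoplus_{a\in Q_1^{*\to i}}F(s(a))\to F(i)$ is a monomorphism with cokernel in $\mathsf X$. Then $(\Phi(\mathsf X),\Phi(\mathsf X)^{\perp})$ is a complete cotorsion pair in $\mathrm{Rep}(Q,\mathsf A)$. (b) Suppose that $Q$ is right rooted and that $\mathsf A$ has exact $|Q_1^{i\to *}|$-indexed products for every vertex $i$ of $Q$. Let $\Psi(\mathsf Y)$ be the class of representations $F$ such that for every vertex $i$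 the canonical morphism $\psi_i^F:F(i)\to\prod_{a\in Q_1^{i\to *}}F(t(a))$ is an epimorphism with kernel in $\mathsf Y$. Then $({}^{\perp}\Psi(\mathsf Y),\Psi(\mathsf Y))$ is a complete cotorsion pair in $\mathrm{Rep}(Q,\mathsf A)$. Here, in an abelian category, $\mathsf S^{\perp}$ (resp. ${}^{\perp}\mathsf S$) is the class of objects $M$ with $\mathrm{Ext}^1(S,M)=0$ (resp. $\mathrm{Ext}^1(M,S)=0$) for all $S\in\mathsf S$; a pair $(\mathsf S,\mathsf T)$ is a cotorsion pair if $\mathsf S^{\perp}=\mathsf T$ and ${}^{\perp}\mathsf T=\mathsf S$, and it is complete if every object $M$ admits an epimorphism $S\to M$ with $S\in\mathsf S$ and kernel in $\mathsf S^{\perp}$, and a monomorphism $M\to T$ with $T\in\mathsf T$ and cokernel in ${}^{\perp}\mathsf T$. For a cardinal $\kappa$, $\mathsf A$ has exact $\kappa$-indexed coproducts if every family of objects indexed by a set of cardinality at most $\kappa$ has a coproduct and every such coproduct of monomorphisms is a monomorphism; exact $\kappa$-indexed products are defined dually. Define subsets $V_\alpha\subseteq Q_0$ for ordinals $\alpha$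 by $V_0=\emptyset$; $V_{\alpha+1}$ is the set of vertices that are not the target of any arrow $a$ with $s(a)\notin\bigcup_{\beta\le\alpha}V_\beta$; and $V_\alpha=\bigcup_{\beta<\alpha}V_\beta$ for $\alpha$ a limit ordinal. The quiver $Q$ is left rooted if $V_\lambda=Q_0$ for some ordinal $\lambda$, and right rooted if its opposite quiver is left rooted. -/

import Mathlib

open CategoryTheory CategoryTheory.Limits

universe w v u v₁ u₁

noncomputable section

namespace QuiverRep

section Cotorsion

variable {C : Type u} [Category.{v} C] [Abelian C]

/-- `Ext¹(X, Y) = 0` in the abelian category `C`. (The vanishing does not depend on the universe in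
which the `Ext`-groups are realised; the standard one always exists.) -/
def Ext1Vanishes (X Y : C) : Prop :=
  letI := HasExt.standard C
  ∀ e : Abelian.Ext X Y 1, e = 0

/-- `𝒳^⊥`: the objects `M` with `Ext¹(X, M) = 0` for all `X` in `𝒳`. -/
def rightPerp (P : ObjectProperty C) : ObjectProperty C :=
  fun M => ∀ X, P X → Ext1Vanishes X M

/-- `^⊥𝒳`: the objects `M` with `Ext¹(M, X) = 0` for all `X` in `𝒳`. -/
def leftPerp (P : ObjectProperty C) : ObjectProperty C :=
  fun M => ∀ X, P X → Ext1Vanishes M X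

/-- `(𝒳, 𝒴)` is a cotorsion pair: `𝒳^⊥ = 𝒴` and `^⊥𝒴 = 𝒳`. Then both `𝒳` and `𝒴` are closed under
isomorphisms and finite direct sums. -/
structure IsCotorsionPair (P R : ObjectProperty C) : Prop where
  rightPerp_eq : rightPerp P = R
  leftPerp_eq : leftPerp R = P

/-- `f : X ⟶ M` is a special `𝒳`-precover of `M`. -/
structure IsSpecialPrecover (P : ObjectProperty C) {X M : C} (f : X ⟶ M) : Prop where
  epi : Epi f
  mem : P X
  kernel_mem : rightPerp P (kernel f)

/-- `g : M ⟶ X` is a special `𝒳`-preenvelope of `M`. -/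
structure IsSpecialPreenvelope (P : ObjectProperty C) {M X : C} (g : M ⟶ X) : Prop where
  mono : Mono g
  mem : P X
  cokernel_mem : leftPerp P (cokernel g)

/-- A cotorsion pair `(𝒳, 𝒴)` is complete if every object has a special `𝒳`-precover and
a special `𝒴`-preenvelope. -/
structure IsCompleteCotorsionPair (P R : ObjectProperty C) : Prop
    extends IsCotorsionPair P R where
  exists_precover : ∀ M : C, ∃ (X : C) (f : X ⟶ M), IsSpecialPrecover P f
  exists_preenvelope : ∀ M : C, ∃ (Y : C) (g : M ⟶ Y), IsSpecialPreenvelope R g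

end Cotorsion

section Coproducts

variable (S : Type w) (A : Type u) [Category.{v} A]

/-- `A` has `|S|`-indexed coproducts: coproducts of all families indexed by sets of cardinality at
most `|S|` exist. -/
class HasCoproductsLE : Prop where
  hasColimits : ∀ U : Type w, Cardinal.mk U ≤ Cardinal.mk S → HasColimitsOfShape (Discrete U) A

/-- `A` has `|S|`-indexed products. -/
class HasProductsLE : Prop where
  hasLimits : ∀ U : Type w, Cardinal.mk U ≤ Cardinal.mk S → HasLimitsOfShape (Discrete U) A

instance [h : HasCoproductsLE S A] : HasColimitsOfShape (Discrete S) A := h.hasColimits S le_rfl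

instance [h : HasProductsLE S A] : HasLimitsOfShape (Discrete S) A := h.hasLimits S le_rfl

/-- `A` has exact `|S|`-indexed coproducts: they exist, and such a coproduct of monomorphisms is
a monomorphism. -/
class HasExactCoproductsLE : Prop extends HasCoproductsLE S A where
  mono_map : ∀ U : Type w, Cardinal.mk U ≤ Cardinal.mk S →
    ∀ (M N : U → A) [HasCoproduct M] [HasCoproduct N] (f : ∀ x, M x ⟶ N x),
      (∀ x, Mono (f x)) → Mono (Limits.Sigma.map f)

/-- `A` has exact `|S|`-indexed products: they exist, and such a product of epimorphisms is
an epimorphism. -/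
class HasExactProductsLE : Prop extends HasProductsLE S A where
  epi_map : ∀ U : Type w, Cardinal.mk U ≤ Cardinal.mk S →
    ∀ (M N : U → A) [HasProduct M] [HasProduct N] (f : ∀ x, M x ⟶ N x),
      (∀ x, Epi (f x)) → Epi (Limits.Pi.map f)

end Coproducts

section Rooted

variable (Q : Type u₁) [Quiver.{v₁} Q]

/-- The transfinite sequence `V_α` of sets of vertices: `V_0 = ∅`; a vertex lies in `V_{α+1}` iff
it is not the target of an arrow whose source lies outside `⋃_{β ≤ α} V_β`; and
`V_α = ⋃_{β < α} V_β` for a limit ordinal `α`. See `rootSeq_zero`, `rootSeq_succ`,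
`rootSeq_limit`. -/
def rootSeq (α : Ordinal.{u₁}) : Set Q :=
  {i | (∃ β, ∃ _ : α = Order.succ β, ¬ ∃ (j : Q) (_ : j ⟶ i), ¬ ∃ γ, ∃ _ : γ ≤ β, j ∈ rootSeq γ) ∨
    (Order.IsSuccLimit α ∧ ∃ β, ∃ _ : β < α, i ∈ rootSeq β)}
termination_by α
decreasing_by
  · subst_vars
    exact Order.lt_succ_of_le (by assumption)
  · assumption

theorem rootSeq_zero : rootSeq Q 0 = ∅ := by
  ext i
  rw [rootSeq]
  simp only [Set.mem_ofPred_eq, Set.mem_empty_iff_false, iff_false, not_or]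
  constructor
  · rintro ⟨β, h, -⟩
    exact (Order.bot_lt_succ β).ne h
  · rintro ⟨h, -⟩
    exact h.not_isMin isMin_bot

theorem rootSeq_succ (α : Ordinal.{u₁}) :
    rootSeq Q (Order.succ α) = {i | ¬ ∃ (j : Q) (_ : j ⟶ i), j ∉ ⋃ β ≤ α, rootSeq Q β} := by
  ext i
  rw [rootSeq]
  simp only [Set.mem_ofPred_eq, Set.mem_iUnion]
  constructor
  · rintro (⟨β, h, hi⟩ | ⟨h, -⟩)
    · obtain rfl := Order.succ_injective h
      exact hi
    · exact absurd h (Order.not_isSuccLimit_succ α)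
  · intro hi
    exact Or.inl ⟨α, rfl, hi⟩

theorem rootSeq_limit (α : Ordinal.{u₁}) (h : Order.IsSuccLimit α) :
    rootSeq Q α = ⋃ β < α, rootSeq Q β := by
  ext i
  rw [rootSeq]
  simp only [Set.mem_ofPred_eq, Set.mem_iUnion]
  constructor
  · rintro (⟨β, rfl, -⟩ | ⟨-, hi⟩)
    · exact absurd h (Order.not_isSuccLimit_succ β)
    · exact hi
  · intro hi
    exact Or.inr ⟨h, hi⟩

/-- `Q` is left rooted if `V_α` is the set of all vertices for some ordinal `α`. -/
def IsLeftRooted : Prop := ∃ α : Ordinal.{u₁}, rootSeq Q α = Set.univ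

/-- `Q` is right rooted if the opposite quiver is left rooted. -/
def IsRightRooted : Prop := IsLeftRooted Qᵒᵖ

end Rooted

section Representations

variable (Q : Type u₁) [Quiver.{v₁} Q] (A : Type u) [Category.{v} A]

/-- The category of `A`-valued representations of `Q`: functors from the free category on `Q`. -/
abbrev Rep := Paths Q ⥤ A

variable {Q A}

/-- The value `F(i)` at a vertex. -/
abbrev Rep.val (F : Rep Q A) (i : Q) : A := F.obj ((Paths.of Q).obj i)

/-- The morphism `F(a) : F(i) ⟶ F(j)` of an arrow. -/
abbrev Rep.arrow (F : Rep Q A) {i j : Q} (a : i ⟶ j) : F.val i ⟶ F.val j :=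
  F.map ((Paths.of Q).map a)

/-- `φ_i : ⨁_{a : j → i} F(j) ⟶ F(i)`; here `Quiver.Costar i` is the type of arrows with
target `i`. -/
def phi (F : Rep Q A) (i : Q) [HasCoproductsLE (Quiver.Costar i) A] :
    (∐ fun a : Quiver.Costar i => F.val a.1) ⟶ F.val i :=
  Limits.Sigma.desc fun a => F.arrow a.2

/-- `ψ_i : F(i) ⟶ ∏_{a : i → j} F(j)`; here `Quiver.Star i` is the type of arrows with
source `i`. -/
def psi (F : Rep Q A) (i : Q) [HasProductsLE (Quiver.Star i) A] :
    F.val i ⟶ ∏ᶜ fun a : Quiver.Star i => F.val a.1 :=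
  Limits.Pi.lift fun a => F.arrow a.2

variable [Abelian A]

/-- `C_i(F)`, the cokernel of `φ_i`. -/
abbrev cokerAt (F : Rep Q A) (i : Q) [HasCoproductsLE (Quiver.Costar i) A] : A :=
  cokernel (phi F i)

/-- `K_i(F)`, the kernel of `ψ_i`. -/
abbrev kerAt (F : Rep Q A) (i : Q) [HasProductsLE (Quiver.Star i) A] : A :=
  kernel (psi F i)

variable (Q)

/-- `Φ(𝒳)`: all `φ_i` are monomorphisms with cokernel in `𝒳`. -/
def Phi [∀ i : Q, HasCoproductsLE (Quiver.Costar i) A] (P : ObjectProperty A) :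
    ObjectProperty (Rep Q A) :=
  fun F => ∀ i : Q, Mono (phi F i) ∧ P (cokerAt F i)

/-- `Ψ(𝒴)`: all `ψ_i` are epimorphisms with kernel in `𝒴`. -/
def Psi [∀ i : Q, HasProductsLE (Quiver.Star i) A] (P : ObjectProperty A) :
    ObjectProperty (Rep Q A) :=
  fun F => ∀ i : Q, Epi (psi F i) ∧ P (kerAt F i)

end Representations

end QuiverRep

end

/-! Rootedness enters only as well-foundedness of the relation "there is an arrow between these
vertices". Since a representation is a functor on a free category, representations, their morphisms
and splittings can all be built vertex by vertex, with one constraint for each arrow and no further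
coherence.

For (a), three constructions carry the proof. If `F` is in `Φ(X)` and `G` is vertexwise in `Y`, an
extension of `F` by `G` splits: a section already chosen at the sources of the arrows into `i`
extends along `φ_i` by lifting a monomorphism with cokernel in `X` against an epimorphism with
kernel in `Y`. Next, any `M` is covered by some `F` in `Φ(X)` with kernel vertexwise in `Y`: factor
`⨁ F(s(a)) ⟶ M(i)` as a monomorphism with cokernel in `X` followed by an epimorphism with kernel in
`Y`. Finally, `M` embeds in a vertexwise `Y`-valued `T` with cokernel in `Φ(X)`: take for `T(i)` a
special preenvelope of the pushout of `M(i)` and `⨁ T(s(a))` over `⨁ M(s(a))`. Only this last step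
needs exact coproducts.

The last two constructions are the required approximations. If `M` lies in `^⊥(Φ(X)^⊥)`, its cover
splits, so `M` is a retract of an object of `Φ(X)`, hence in `Φ(X)`. Part (b) is the dual argument,
written out with products and kernels. -/

noncomputable section

namespace QuiverRep

/-! ### Vanishing of `Ext¹`, splitting of extensions, and lifting. -/

section ExtOne

variable {C : Type u} [Category.{v} C] [Abelian C]

/-- Every class in `Ext¹(X, Y)` is killed by the pullback along some epimorphism onto `X`. -/
theorem exists_epi_mk₀_comp_eq_zero [HasExt.{w} C] {X Y : C} (e : Abelian.Ext X Y 1) :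
    ∃ (E : C) (p : E ⟶ X), Epi p ∧ (Abelian.Ext.mk₀ p).comp e (zero_add 1) = 0 := by
  let := HasDerivedCategory.standard C
  let K := (CochainComplex.singleFunctor C 0).obj X
  let L := (CochainComplex.singleFunctor C 0).obj Y
  let h : DerivedCategory.Q.obj K ⟶ (DerivedCategory.Q.obj L)⟦((1 : ℕ) : ℤ)⟧ := e.hom
  let f : DerivedCategory.Q.obj K ⟶ DerivedCategory.Q.obj (L⟦((1 : ℕ) : ℤ)⟧) :=
    h ≫ (DerivedCategory.Q.commShiftIso ((1 : ℕ) : ℤ)).inv.app L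
  -- The class is a fraction `s⁻¹ ≫ g` with `s : Z ⟶ X` a quasi-isomorphism and `Z` in degrees at
  -- most 0. The epimorphism sought is `Z⁰ ⟶ H⁰(Z) ≅ X`; it kills the class because `Y[1]` lives in
  -- degree -1, so `g` vanishes in degree 0.
  obtain ⟨Z, hZ, s, hs, g, hf⟩ := DerivedCategory.right_fac_of_isStrictlyLE f 0
  have hd : ∀ k, (ComplexShape.up ℤ).Rel 0 k → Z.d 0 k = 0 := fun k hk =>
    (Z.isZero_of_isStrictlyLE 0 k (by simp at hk; omega)).eq_of_tgt _ _
  let i : (CochainComplex.singleFunctor C 0).obj (Z.X 0) ⟶ Z :=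
    HomologicalComplex.mkHomFromSingle (𝟙 _) fun k hk => by rw [hd k hk, comp_zero]
  obtain ⟨p, hp⟩ := (CochainComplex.singleFunctor C 0).map_surjective (i ≫ s)
  have hig : i ≫ g = 0 := by
    apply HomologicalComplex.from_single_hom_ext
    refine IsZero.eq_of_tgt ?_ _ _
    exact HomologicalComplex.isZero_single_obj_X (ComplexShape.up ℤ) 0 Y (0 + ((1 : ℕ) : ℤ))
      (by simp)
  refine ⟨Z.X 0, p, ?_, ?_⟩
  · have h1 : Epi (HomologicalComplex.homologyMap i 0) := by
      have hz : IsIso (HomologicalComplex.iCycles Z 0) :=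
        Z.isIso_iCycles 0 1 (by simp) (hd 1 (by simp))
      have hz' : IsIso (HomologicalComplex.iCycles
          ((CochainComplex.singleFunctor C 0).obj (Z.X 0)) 0) :=
        HomologicalComplex.isIso_iCycles _ 0 1 (by simp) (IsZero.eq_of_tgt
          (HomologicalComplex.isZero_single_obj_X _ _ _ _ (by simp)) _ _)
      have hi : IsIso (i.f 0) := by
        simp only [i, HomologicalComplex.mkHomFromSingle_f, Category.comp_id]
        exact (HomologicalComplex.singleObjXSelf (ComplexShape.up ℤ) 0 (Z.X 0)).isIso_hom
      have hc : IsIso (HomologicalComplex.cyclesMap i 0) := by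
        have := HomologicalComplex.cyclesMap_i i 0
        have h2 : IsIso (HomologicalComplex.cyclesMap i 0 ≫ HomologicalComplex.iCycles Z 0) := by
          rw [this]; infer_instance
        exact IsIso.of_isIso_comp_right _ (HomologicalComplex.iCycles Z 0)
      have := HomologicalComplex.homologyπ_naturality i 0
      have h3 : Epi (HomologicalComplex.homologyπ _ 0 ≫ HomologicalComplex.homologyMap i 0) := by
        rw [this]; infer_instance
      exact epi_of_epi (HomologicalComplex.homologyπ _ 0) _
    have h2 : IsIso (HomologicalComplex.homologyMap s 0) := by
      rw [DerivedCategory.isIso_Q_map_iff_quasiIso] at hs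
      infer_instance
    have h3 : Epi (HomologicalComplex.homologyMap
        ((CochainComplex.singleFunctor C 0).map p) 0) := by
      rw [hp, HomologicalComplex.homologyMap_comp]
      infer_instance
    have h4 := NatIso.naturality_1
      (HomologicalComplex.homologyFunctorSingleIso C (ComplexShape.up ℤ) 0) p
    dsimp at h4
    rw [← h4]
    have : Epi ((HomologicalComplex.homologyFunctor C (ComplexShape.up ℤ) 0).map
      ((HomologicalComplex.single C (ComplexShape.up ℤ) 0).map p)) := h3
    infer_instance
  · have hpf : DerivedCategory.Q.map ((CochainComplex.singleFunctor C 0).map p) ≫ f = 0 := by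
      rw [hf, hp, Functor.map_comp, Category.assoc, IsIso.hom_inv_id_assoc, ← Functor.map_comp,
        hig, Functor.map_zero]
    have hph : DerivedCategory.Q.map ((CochainComplex.singleFunctor C 0).map p) ≫ h = 0 := by
      rw [← cancel_mono ((DerivedCategory.Q.commShiftIso ((1 : ℕ) : ℤ)).inv.app L),
        Category.assoc, zero_comp]
      exact hpf
    apply Abelian.Ext.ext
    rw [Abelian.Ext.comp_hom, Abelian.Ext.mk₀_hom, ShiftedHom.mk₀_comp, Abelian.Ext.zero_hom]
    exact hph

/-- The cokernel sequence of the pushout of a monomorphism. -/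
theorem shortExact_of_isPushout {S : ShortComplex C} (hS : S.ShortExact) {Y P : C}
    {k : S.X₁ ⟶ Y} {l : S.X₂ ⟶ P} {i : Y ⟶ P} (sq : IsPushout S.f k l i) :
    (ShortComplex.mk i (sq.desc S.g 0 (by simp)) (by simp)).ShortExact := by
  have := hS.mono_f
  have := hS.epi_g
  have : Mono i := (MorphismProperty.monomorphisms C).of_isPushout sq.flip
    (MorphismProperty.monomorphisms.infer_property S.f)
  have : Epi (sq.desc S.g 0 (by simp)) := epi_of_epi_fac (sq.inl_desc S.g 0 (by simp))
  refine ShortComplex.ShortExact.mk' (ShortComplex.exact_of_g_is_cokernel _ ?_) ‹Mono i› this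
  refine Cofork.IsColimit.mk' _ fun s => ?_
  have hs : i ≫ s.π = 0 := by simpa only [zero_comp] using s.condition
  refine ⟨hS.exact.desc (l ≫ s.π) (by rw [sq.w_assoc, hs]; exact comp_zero),
    ?_, fun {m} hm => ?_⟩
  · refine sq.hom_ext ?_ ?_ <;> simp [hs]
  · rw [← cancel_epi S.g]
    have := l ≫= hm
    simpa using this

theorem shortExact_kernel {X Y : C} (f : X ⟶ Y) [Epi f] :
    (ShortComplex.mk (kernel.ι f) f (kernel.condition f)).ShortExact :=
  .mk' (ShortComplex.exact_kernel f) inferInstance ‹_›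

theorem shortExact_cokernel {X Y : C} (f : X ⟶ Y) [Mono f] :
    (ShortComplex.mk f (cokernel.π f) (cokernel.condition f)).ShortExact :=
  .mk' (ShortComplex.exact_cokernel f) ‹_› inferInstance

/-- `Ext¹(X, Y) = 0` if every extension of `X` by `Y` splits. -/
theorem ext1Vanishes_of_splits {X Y : C}
    (H : ∀ {E : C} (i : Y ⟶ E) (p : E ⟶ X) (w : i ≫ p = 0),
      (ShortComplex.mk i p w).ShortExact → ∃ s, s ≫ p = 𝟙 X) :
    Ext1Vanishes X Y := by
  let := HasExt.standard C
  intro e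
  obtain ⟨E, p, hp, hpe⟩ := exists_epi_mk₀_comp_eq_zero e
  have hS := shortExact_kernel p
  -- Being killed by `p`, the class is the image of the class of `p` under some `k : kernel p ⟶ Y`.
  -- A splitting of the pushout along `k` extends `k` to `E`, which forces this image to be zero.
  obtain ⟨x, rfl⟩ := Abelian.Ext.contravariant_sequence_exact₃ hS Y e hpe (add_zero 1)
  obtain ⟨k, rfl⟩ := (Abelian.Ext.mk₀_bijective _ _).2 x
  have sq := IsPushout.of_hasPushout (kernel.ι p) k
  have hP := shortExact_of_isPushout hS sq
  obtain ⟨s, hs⟩ := H _ _ _ hP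
  have := hP.mono_f
  let σ := ShortComplex.Splitting.ofExactOfSection _ hP.exact s hs hP.mono_f
  have hr : pushout.inr (kernel.ι p) k ≫ σ.r = 𝟙 Y := σ.f_r
  have hk : k = kernel.ι p ≫ pushout.inl (kernel.ι p) k ≫ σ.r := by
    rw [sq.w_assoc, hr, Category.comp_id]
  rw [hk, ← Abelian.Ext.mk₀_comp_mk₀, hS.extClass_comp_assoc]

theorem Ext1Vanishes.of_retract_left {X X' Y : C} (h : Ext1Vanishes X Y) (i : X' ⟶ X) (r : X ⟶ X')
    (hir : i ≫ r = 𝟙 X') : Ext1Vanishes X' Y := by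
  let := HasExt.standard C
  intro e
  rw [← Abelian.Ext.mk₀_id_comp e, ← hir, ← Abelian.Ext.mk₀_comp_mk₀_assoc,
    h ((Abelian.Ext.mk₀ r).comp e (zero_add 1)), Abelian.Ext.comp_zero]

theorem Ext1Vanishes.of_retract_right {X Y Y' : C} (h : Ext1Vanishes X Y) (i : Y' ⟶ Y)
    (r : Y ⟶ Y') (hir : i ≫ r = 𝟙 Y') : Ext1Vanishes X Y' := by
  let := HasExt.standard C
  intro e
  rw [← Abelian.Ext.comp_mk₀_id e, ← hir, ← Abelian.Ext.mk₀_comp_mk₀,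
    ← Abelian.Ext.comp_assoc_of_third_deg_zero,
    h (e.comp (Abelian.Ext.mk₀ i) (add_zero 1)), Abelian.Ext.zero_comp]

theorem Ext1Vanishes.of_shortExact {S : ShortComplex C} (hS : S.ShortExact) {Y : C}
    (h₁ : Ext1Vanishes S.X₁ Y) (h₃ : Ext1Vanishes S.X₃ Y) : Ext1Vanishes S.X₂ Y := by
  let := HasExt.standard C
  intro e
  obtain ⟨x, rfl⟩ := Abelian.Ext.contravariant_sequence_exact₂ hS Y e (h₁ _)
  rw [h₃ x, Abelian.Ext.comp_zero]

/-- An extension of `X` by `Y` splits if `Ext¹(X, Y) = 0`. -/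
theorem Ext1Vanishes.exists_section {S : ShortComplex C} (hS : S.ShortExact)
    (h : Ext1Vanishes S.X₃ S.X₁) : ∃ s, s ≫ S.g = 𝟙 S.X₃ := by
  let := HasExt.standard C
  obtain ⟨x, hx⟩ := Abelian.Ext.covariant_sequence_exact₃ _ hS (Abelian.Ext.mk₀ (𝟙 S.X₃)) rfl (h _)
  obtain ⟨s, rfl⟩ := (Abelian.Ext.mk₀_bijective _ _).2 x
  exact ⟨s, (Abelian.Ext.mk₀_bijective _ _).1 (by rw [← Abelian.Ext.mk₀_comp_mk₀, hx])⟩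

/-- Monomorphisms lift against epimorphisms if `Ext¹` of the cokernel by the kernel vanishes. -/
theorem Ext1Vanishes.exists_lift {B D E F : C} {f : B ⟶ D} {g : E ⟶ F} [Mono f] [Epi g]
    (h : Ext1Vanishes (cokernel f) (kernel g)) {u : B ⟶ E} {v : D ⟶ F} (w : u ≫ g = f ≫ v) :
    ∃ l : D ⟶ E, f ≫ l = u ∧ l ≫ g = v := by
  let := HasExt.standard C
  have hf := shortExact_cokernel f
  have hg := shortExact_kernel g
  -- The obstruction to lifting `v` through `g` dies on `B`, where `u` is a lift, so it comes from
  -- `Ext¹(cokernel f, kernel g) = 0`.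
  have hv : (Abelian.Ext.mk₀ v).comp hg.extClass (zero_add 1) = 0 := by
    obtain ⟨x, hx⟩ := Abelian.Ext.contravariant_sequence_exact₂ hf _
      ((Abelian.Ext.mk₀ v).comp hg.extClass (zero_add 1)) (by
        rw [Abelian.Ext.mk₀_comp_mk₀_assoc, ← w, ← Abelian.Ext.mk₀_comp_mk₀_assoc,
          hg.comp_extClass, Abelian.Ext.comp_zero])
    rw [← hx, h x, Abelian.Ext.comp_zero]
  obtain ⟨x, hx⟩ := Abelian.Ext.covariant_sequence_exact₃ _ hg (Abelian.Ext.mk₀ v) rfl hv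
  obtain ⟨l, rfl⟩ := (Abelian.Ext.mk₀_bijective _ _).2 x
  have hl : l ≫ g = v := (Abelian.Ext.mk₀_bijective _ _).1 (by rw [← Abelian.Ext.mk₀_comp_mk₀, hx])
  -- The lift `l` need not restrict to `u`. The error lands in `kernel g` and extends along `f` by
  -- the same vanishing, which corrects `l`.
  have hk : (u - f ≫ l) ≫ g = 0 := by simp [hl, w]
  obtain ⟨y, hy⟩ := Abelian.Ext.contravariant_sequence_exact₁ hf _
    (Abelian.Ext.mk₀ (kernel.lift g _ hk)) rfl (h _)
  obtain ⟨k, rfl⟩ := (Abelian.Ext.mk₀_bijective _ _).2 y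
  have hk' : f ≫ k = kernel.lift g _ hk :=
    (Abelian.Ext.mk₀_bijective _ _).1 (by rw [← Abelian.Ext.mk₀_comp_mk₀, hy])
  refine ⟨l + k ≫ kernel.ι g, ?_, by simp [hl]⟩
  rw [Preadditive.comp_add, ← Category.assoc, hk', kernel.lift_ι, add_sub_cancel]

end ExtOne

/-! ### Closure properties and factorizations for a cotorsion pair. -/

section CotorsionPairs

variable {C : Type u} [Category.{v} C] [Abelian C] {X Y : ObjectProperty C}

theorem IsCotorsionPair.ext1Vanishes (h : IsCotorsionPair X Y) {M N : C} (hM : X M) (hN : Y N) :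
    Ext1Vanishes M N := by
  rw [← h.rightPerp_eq] at hN
  exact hN M hM

theorem IsCotorsionPair.left_of_retract (h : IsCotorsionPair X Y) {M N : C} (hN : X N) (i : M ⟶ N)
    (r : N ⟶ M) (hir : i ≫ r = 𝟙 M) : X M := by
  rw [← h.leftPerp_eq]
  exact fun _ hT => (h.ext1Vanishes hN hT).of_retract_left i r hir

theorem IsCotorsionPair.right_of_retract (h : IsCotorsionPair X Y) {M N : C} (hN : Y N) (i : M ⟶ N)
    (r : N ⟶ M) (hir : i ≫ r = 𝟙 M) : Y M := by
  rw [← h.rightPerp_eq]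
  exact fun _ hT => (h.ext1Vanishes hT hN).of_retract_right i r hir

theorem IsCotorsionPair.left_of_iso (h : IsCotorsionPair X Y) {M N : C} (hN : X N) (e : M ≅ N) :
    X M :=
  h.left_of_retract hN e.hom e.inv e.hom_inv_id

theorem IsCotorsionPair.right_of_iso (h : IsCotorsionPair X Y) {M N : C} (hN : Y N) (e : M ≅ N) :
    Y M :=
  h.right_of_retract hN e.hom e.inv e.hom_inv_id

theorem IsCotorsionPair.left_of_shortExact (h : IsCotorsionPair X Y) {S : ShortComplex C}
    (hS : S.ShortExact) (h₁ : X S.X₁) (h₃ : X S.X₃) : X S.X₂ := by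
  rw [← h.leftPerp_eq]
  exact fun _ hT => .of_shortExact hS (h.ext1Vanishes h₁ hT) (h.ext1Vanishes h₃ hT)

/-- Monomorphisms with cokernel in `X` are closed under composition. -/
theorem IsCotorsionPair.left_cokernel_comp (h : IsCotorsionPair X Y) {A B D : C} (f : A ⟶ B)
    (g : B ⟶ D) [Mono g] (hf : X (cokernel f)) (hg : X (cokernel g)) :
    X (cokernel (f ≫ g)) := by
  -- This pushout yields the exact sequence `0 ⟶ cokernel f ⟶ cokernel (f ≫ g) ⟶ cokernel g ⟶ 0`.
  have sq : IsPushout g (cokernel.π f) (cokernel.π (f ≫ g))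
      (cokernel.map f (f ≫ g) (𝟙 A) g (by simp)) := by
    refine ⟨⟨by simp⟩, ⟨PushoutCocone.IsColimit.mk _
      (fun s => cokernel.desc _ s.inl ?_) (fun s => by simp) (fun s => ?_) fun s m hm _ => ?_⟩⟩
    · rw [Category.assoc, s.condition, cokernel.condition_assoc, zero_comp]
    · ext
      simp [s.condition]
    · ext
      simp [hm]
  exact h.left_of_shortExact (shortExact_of_isPushout (shortExact_cokernel g) sq) hf hg

/-- Every morphism factors as a monomorphism with cokernel in `X` followed by an epimorphism with
kernel in `Y`. -/
theorem IsCompleteCotorsionPair.exists_factorization (h : IsCompleteCotorsionPair X Y) {B M : C}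
    (g : B ⟶ M) :
    ∃ (Z : C) (i : B ⟶ Z) (p : Z ⟶ M), Mono i ∧ X (cokernel i) ∧ Epi p ∧ Y (kernel p) ∧
      i ≫ p = g := by
  obtain ⟨X₀, f, hf⟩ := h.exists_precover M
  have := hf.epi
  -- Adding `X₀` makes `g` epi at the cost of an inclusion with cokernel `X₀`. Pushing out along a
  -- preenvelope of `kernel q` then replaces the kernel by an object of `Y`, and enlarges `B ⊞ X₀`
  -- only by a cokernel in `X`.
  let q : B ⊞ X₀ ⟶ M := biprod.desc g f
  have : Epi q := epi_of_epi_fac (biprod.inr_desc g f)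
  obtain ⟨Y₀, j, hj⟩ := h.exists_preenvelope (kernel q)
  have := hj.mono
  have hS := shortExact_kernel q
  have sq := IsPushout.of_hasPushout (kernel.ι q) j
  have hP := shortExact_of_isPushout hS sq
  have : IsIso (cokernel.map _ _ _ _ sq.flip.w) := isIso_cokernel_map_of_isPushout sq.flip
  have hX₀ : X (cokernel (biprod.inl : B ⟶ B ⊞ X₀)) := by
    refine h.left_of_retract hf.mem (cokernel.desc _ biprod.snd (by simp))
      (biprod.inr ≫ cokernel.π _) ?_
    ext <;> simp
  have hj' : X (cokernel (pushout.inl (kernel.ι q) j)) := by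
    refine h.left_of_iso ?_ (asIso (cokernel.map _ _ _ _ sq.flip.w)).symm
    rw [← h.leftPerp_eq]
    exact hj.cokernel_mem
  refine ⟨pushout (kernel.ι q) j, biprod.inl ≫ pushout.inl _ _, sq.desc q 0 (by simp),
    mono_comp _ _, h.left_cokernel_comp _ _ hX₀ hj', hP.epi_g, ?_, ?_⟩
  · exact h.right_of_iso hj.mem
      (IsLimit.conePointUniqueUpToIso (kernelIsKernel _) hP.fIsKernel)
  · rw [Category.assoc, sq.inl_desc]
    exact biprod.inl_desc g f

end CotorsionPairs

/-! ### Rooted quivers and well-founded recursion. -/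

section WellFounded

/-- Dependent well-founded recursion along a total relation. -/
theorem _root_.WellFounded.exists_forall_rel {ι : Type*} {r : ι → ι → Prop} (hr : WellFounded r)
    {D : ι → Type*} (R : ∀ i, D i → (∀ j, r j i → D j) → Prop)
    (h : ∀ i (y : ∀ j, r j i → D j), ∃ x, R i x y) :
    ∃ F : ∀ i, D i, ∀ i, R i (F i) fun j _ => F j := by
  choose G hG using h
  refine ⟨hr.fix G, fun i => ?_⟩
  have := hG i fun j _ => hr.fix G j
  rwa [← hr.fix_eq G i] at this

variable {Q : Type u₁} [Quiver.{v₁} Q]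

/-- A vertex admitted at a successor stage receives arrows only from vertices of earlier stages, so
accessibility propagates by transfinite induction. -/
theorem acc_of_mem_rootSeq (α : Ordinal.{u₁}) :
    ∀ i ∈ rootSeq Q α, Acc (fun j i : Q => Nonempty (j ⟶ i)) i := by
  induction α using WellFoundedLT.induction with
  | ind α ih =>
    intro i hi
    rw [rootSeq] at hi
    obtain ⟨β, rfl, h⟩ | ⟨-, β, hβ, h⟩ := hi
    · refine ⟨_, fun j ⟨a⟩ => ?_⟩
      by_contra hj
      exact h ⟨j, a, fun ⟨γ, hγ, hjγ⟩ => hj (ih γ (Order.lt_succ_of_le hγ) j hjγ)⟩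
    · exact ih β hβ i h

theorem IsLeftRooted.wellFounded (h : IsLeftRooted Q) :
    WellFounded fun j i : Q => Nonempty (j ⟶ i) := by
  obtain ⟨α, hα⟩ := h
  exact ⟨fun i => acc_of_mem_rootSeq α i (hα ▸ Set.mem_univ i)⟩

theorem IsRightRooted.wellFounded (h : IsRightRooted Q) :
    WellFounded fun j i : Q => Nonempty (i ⟶ j) := by
  refine Subrelation.wf ?_ (InvImage.wf Opposite.op (IsLeftRooted.wellFounded h))
  exact fun ⟨a⟩ => ⟨a.op⟩

end WellFounded

/-! ### Representations and their morphisms, vertex by vertex. -/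

section Representations

variable {Q : Type u₁} [Quiver.{v₁} Q] {A : Type u} [Category.{v} A]

/-- The representation with given values at the vertices and at the arrows. -/
def Rep.mk (D : Q → A) (m : ∀ {i j : Q}, (i ⟶ j) → (D i ⟶ D j)) : Rep Q A :=
  Paths.lift ⟨D, m⟩

theorem Rep.mk_arrow (D : Q → A) (m : ∀ {i j : Q}, (i ⟶ j) → (D i ⟶ D j)) {i j : Q} (a : i ⟶ j) :
    (Rep.mk D m).arrow a = m a :=
  Paths.lift_toPath ⟨D, m⟩ a

/-- The component of a morphism of representations at a vertex. -/
abbrev Rep.appAt {F G : Rep Q A} (t : F ⟶ G) (i : Q) : F.val i ⟶ G.val i :=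
  t.app ((Paths.of Q).obj i)

theorem Rep.arrow_appAt {F G : Rep Q A} (t : F ⟶ G) {i j : Q} (a : i ⟶ j) :
    F.arrow a ≫ Rep.appAt t j = Rep.appAt t i ≫ G.arrow a :=
  t.naturality _

/-- The morphism of representations with given components. -/
def Rep.homMk {F G : Rep Q A} (t : ∀ i, F.val i ⟶ G.val i)
    (h : ∀ {i j : Q} (a : i ⟶ j), F.arrow a ≫ t j = t i ≫ G.arrow a) : F ⟶ G :=
  Paths.liftNatTrans t h

theorem Rep.hom_ext {F G : Rep Q A} {s t : F ⟶ G} (h : ∀ i, Rep.appAt s i = Rep.appAt t i) :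
    s = t :=
  NatTrans.ext (funext h)

theorem Rep.epi_of_appAt {F G : Rep Q A} (t : F ⟶ G) (h : ∀ i, Epi (Rep.appAt t i)) : Epi t :=
  have : ∀ i, Epi (t.app i) := h
  NatTrans.epi_of_epi_app t

theorem Rep.mono_of_appAt {F G : Rep Q A} (t : F ⟶ G) (h : ∀ i, Mono (Rep.appAt t i)) : Mono t :=
  have : ∀ i, Mono (t.app i) := h
  NatTrans.mono_of_mono_app t

theorem Rep.ι_phi (F : Rep Q A) (i : Q) [HasCoproductsLE (Quiver.Costar i) A]
    (a : Quiver.Costar i) :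
    Sigma.ι (fun a : Quiver.Costar i => F.val a.1) a ≫ phi F i = F.arrow a.2 :=
  Sigma.ι_desc _ _

theorem Rep.psi_π (F : Rep Q A) (i : Q) [HasProductsLE (Quiver.Star i) A]
    (a : Quiver.Star i) : psi F i ≫ Pi.π (fun a : Quiver.Star i => F.val a.1) a = F.arrow a.2 :=
  Pi.lift_π _ _

theorem phi_appAt {F G : Rep Q A} (t : F ⟶ G) (i : Q) [HasCoproductsLE (Quiver.Costar i) A] :
    phi F i ≫ Rep.appAt t i = Limits.Sigma.map (fun a : Quiver.Costar i => Rep.appAt t a.1) ≫ phi G i := by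
  refine Sigma.hom_ext _ _ fun a => ?_
  rw [← Category.assoc, Rep.ι_phi, Sigma.ι_map_assoc, Rep.ι_phi, Rep.arrow_appAt]

theorem appAt_psi {F G : Rep Q A} (t : F ⟶ G) (i : Q) [HasProductsLE (Quiver.Star i) A] :
    Rep.appAt t i ≫ psi G i = psi F i ≫ Limits.Pi.map (fun a : Quiver.Star i => Rep.appAt t a.1) := by
  refine Pi.hom_ext _ _ fun a => ?_
  rw [Category.assoc, Category.assoc, Rep.psi_π, Pi.map_π, ← Category.assoc, Rep.psi_π,
    Rep.arrow_appAt]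

variable [Abelian A]

theorem Rep.shortExact_val {S : ShortComplex (Rep Q A)} (hS : S.ShortExact) (i : Q) :
    (ShortComplex.mk (Rep.appAt S.f i) (Rep.appAt S.g i)
      (by rw [← NatTrans.comp_app, S.zero]; rfl)).ShortExact :=
  hS.map_of_exact ((evaluation _ _).obj ((Paths.of Q).obj i))

/-- Kernels of morphisms of representations are computed at the vertices. -/
def Rep.kernelVal {F G : Rep Q A} (t : F ⟶ G) (i : Q) :
    (kernel t).val i ≅ kernel (Rep.appAt t i) :=
  PreservesKernel.iso ((evaluation _ _).obj ((Paths.of Q).obj i)) t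

/-- Cokernels of morphisms of representations are computed at the vertices. -/
def Rep.cokernelVal {F G : Rep Q A} (t : F ⟶ G) (i : Q) :
    (cokernel t).val i ≅ cokernel (Rep.appAt t i) :=
  PreservesCokernel.iso ((evaluation _ _).obj ((Paths.of Q).obj i)) t

end Representations

/-! ### Pushout and pullback squares that transfer `φ` to cokernels and `ψ` to kernels. -/

section Squares

variable {A : Type u} [Category.{v} A] [Abelian A]

/-- The comparison square of two cokernel sequences is a pushout. -/
theorem isPushout_cokernel {M' T' C' P : A} {S : ShortComplex A} (hS : S.ShortExact)
    {α : M' ⟶ T'} {m : M' ⟶ S.X₁} {l : T' ⟶ P} {r : S.X₁ ⟶ P} (sq : IsPushout α m l r) {π : T' ⟶ C'}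
    [Epi π] (hπ : α ≫ π = m ≫ 0) {d : P ⟶ S.X₂} (hd : r ≫ d = S.f)
    {c : C' ⟶ S.X₃} (hc : π ≫ c = l ≫ d ≫ S.g) :
    IsPushout d (sq.desc π 0 hπ) S.g c := by
  have := hS.epi_g
  -- A cocone leg out of `S.X₂` kills `S.f = r ≫ d`, because the other leg vanishes on `r`; hence it
  -- descends along `S.g`.
  have hf : ∀ s : PushoutCocone d (sq.desc π 0 hπ), S.f ≫ s.inl = 0 := fun s => by
    rw [← hd, Category.assoc, s.condition, sq.inr_desc_assoc, zero_comp]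
  refine ⟨⟨sq.hom_ext ?_ ?_⟩, ⟨PushoutCocone.IsColimit.mk _ (fun s => hS.exact.desc s.inl (hf s))
    (fun s => hS.exact.g_desc _ _) (fun s => ?_) fun s m hm _ => ?_⟩⟩
  · rw [sq.inl_desc_assoc, hc]
  · rw [← Category.assoc, hd, S.zero, sq.inr_desc_assoc, zero_comp]
  · rw [← cancel_epi π, ← Category.assoc, hc, Category.assoc, Category.assoc, hS.exact.g_desc,
      s.condition, sq.inl_desc_assoc]
  · rw [← cancel_epi S.g, hm, hS.exact.g_desc]

/-- The comparison square of two kernel sequences is a pullback. -/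
theorem isPullback_kernel {M' T' K' P : A} {S : ShortComplex A} (hS : S.ShortExact)
    {l : P ⟶ T'} {r : P ⟶ S.X₃} {α : T' ⟶ M'} {m : S.X₃ ⟶ M'} (sq : IsPullback l r α m)
    {κ : K' ⟶ T'} [Mono κ] (hκ : κ ≫ α = 0 ≫ m) {d : S.X₂ ⟶ P} (hd : d ≫ r = S.g)
    {c : S.X₁ ⟶ K'} (hc : c ≫ κ = S.f ≫ d ≫ l) :
    IsPullback S.f c d (sq.lift κ 0 hκ) := by
  have := hS.mono_f
  have hf : ∀ s : PullbackCone d (sq.lift κ 0 hκ), s.fst ≫ S.g = 0 := fun s => by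
    rw [← hd, ← Category.assoc, s.condition, Category.assoc, sq.lift_snd, comp_zero]
  refine ⟨⟨sq.hom_ext ?_ ?_⟩, ⟨PullbackCone.IsLimit.mk _ (fun s => hS.exact.lift s.fst (hf s))
    (fun s => hS.exact.lift_f _ _) (fun s => ?_) fun s m hm _ => ?_⟩⟩
  · rw [Category.assoc, Category.assoc, sq.lift_fst, hc]
  · rw [Category.assoc, hd, S.zero, Category.assoc, sq.lift_snd, comp_zero]
  · rw [← cancel_mono κ, Category.assoc, hc, ← Category.assoc, hS.exact.lift_f, ← Category.assoc,
      s.condition, Category.assoc, sq.lift_fst]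
  · rw [← cancel_mono S.f, hm, hS.exact.lift_f]

end Squares

/-! ### The class `Φ(X)`: retracts, orthogonality and covers. -/

section Phi

variable {Q : Type u₁} [Quiver.{v₁} Q] {A : Type u} [Category.{v} A] [Abelian A]
  {X Y : ObjectProperty A} [∀ i : Q, HasCoproductsLE (Quiver.Costar i) A]

/-- By naturality `φ_i` of `G` is a retract of `φ_i` of `F`. A coproduct of split monomorphisms is
split, so exact coproducts are not needed. -/
theorem Phi.of_retract (h : IsCotorsionPair X Y) {F G : Rep Q A} (hF : Phi Q X F)
    (s : G ⟶ F) (r : F ⟶ G) (hsr : s ≫ r = 𝟙 G) : Phi Q X G := by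
  have hi : ∀ i, Rep.appAt s i ≫ Rep.appAt r i = 𝟙 _ := fun i => by
    rw [← NatTrans.comp_app, hsr]; rfl
  intro i
  have := (hF i).1
  constructor
  · have h1 : Mono (Limits.Sigma.map fun a : Quiver.Costar i => Rep.appAt s a.1) := by
      have : IsSplitMono (Limits.Sigma.map fun a : Quiver.Costar i => Rep.appAt s a.1) := by
        refine .mk' ⟨Limits.Sigma.map fun a : Quiver.Costar i => Rep.appAt r a.1, ?_⟩
        refine Sigma.hom_ext _ _ fun a => ?_
        rw [Sigma.ι_map_assoc, Sigma.ι_map, reassoc_of% (hi a.1), Category.comp_id]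
      infer_instance
    have h2 : Mono (phi G i ≫ Rep.appAt s i) := by
      rw [phi_appAt]; infer_instance
    exact mono_of_mono _ (Rep.appAt s i)
  · refine h.left_of_retract (hF i).2 (cokernel.map _ _ _ _ (phi_appAt s i))
      (cokernel.map _ _ _ _ (phi_appAt r i)) ?_
    ext
    simp [reassoc_of% (hi i)]

/-- Objects of `Φ(X)` have no extensions by vertexwise `Y`-valued representations. -/
theorem ext1Vanishes_of_phi (hQ : IsLeftRooted Q) (h : IsCotorsionPair X Y) {F G : Rep Q A}
    (hF : Phi Q X F) (hG : ∀ i, Y (G.val i)) : Ext1Vanishes F G := by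
  refine ext1Vanishes_of_splits fun {E} i p w hS => ?_
  obtain ⟨s, hs⟩ := hQ.wellFounded.exists_forall_rel
    (D := fun i => {s : F.val i ⟶ E.val i // s ≫ Rep.appAt p i = 𝟙 _})
    (fun i x y => ∀ a : Quiver.Costar i, F.arrow a.2 ≫ x.1 = (y a.1 ⟨a.2⟩).1 ≫ E.arrow a.2)
    (fun j y => by
      have hj := Rep.shortExact_val hS j
      have : Epi (Rep.appAt p j) := hj.epi_g
      have := (hF j).1
      have hK : Y (kernel (Rep.appAt p j)) := h.right_of_iso (hG j)
        (IsLimit.conePointUniqueUpToIso (kernelIsKernel _) hj.fIsKernel)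
      -- The sections at the sources define `u` on the coproduct; a diagonal filler is a section at
      -- `j` compatible with every incoming arrow.
      obtain ⟨l, hl, hl'⟩ := (h.ext1Vanishes (hF j).2 hK).exists_lift (f := phi F j)
        (g := Rep.appAt p j) (v := 𝟙 _)
        (u := Limits.Sigma.desc fun a : Quiver.Costar j => (y a.1 ⟨a.2⟩).1 ≫ E.arrow a.2) (by
          refine Sigma.hom_ext _ _ fun a => ?_
          rw [Sigma.ι_desc_assoc, Category.assoc, Rep.arrow_appAt, ← Category.assoc,
            (y a.1 ⟨a.2⟩).2, Category.id_comp, Category.comp_id, Rep.ι_phi])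
      refine ⟨⟨l, hl'⟩, fun a => ?_⟩
      rw [← Rep.ι_phi, Category.assoc, hl, Sigma.ι_desc])
  refine ⟨Rep.homMk (fun i => (s i).1) fun {j k} a => hs k ⟨j, a⟩, Rep.hom_ext fun i => (s i).2⟩

/-- Every representation is a quotient of an object of `Φ(X)` by a vertexwise `Y`-valued one. -/
theorem exists_phi_epi (hQ : IsLeftRooted Q) (h : IsCompleteCotorsionPair X Y) (M : Rep Q A) :
    ∃ (F : Rep Q A) (p : F ⟶ M), Epi p ∧ Phi Q X F ∧ ∀ i, Y ((kernel p).val i) := by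
  obtain ⟨D, hD⟩ := hQ.wellFounded.exists_forall_rel
    (D := fun i => {D : Over (M.val i) // Epi D.hom ∧ Y (kernel D.hom)})
    (fun i x y => ∃ e : (∐ fun a : Quiver.Costar i => (y a.1 ⟨a.2⟩).1.left) ⟶ x.1.left,
      Mono e ∧ X (cokernel e) ∧
        e ≫ x.1.hom = Limits.Sigma.desc fun a : Quiver.Costar i => (y a.1 ⟨a.2⟩).1.hom ≫ M.arrow a.2)
    (fun i y => by
      -- The monomorphism `e` will be `φ_i` of the cover, and `p` its component at `i`.
      obtain ⟨Z, e, p, h1, h2, h3, h4, h5⟩ := h.exists_factorization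
        (Limits.Sigma.desc fun a : Quiver.Costar i => (y a.1 ⟨a.2⟩).1.hom ≫ M.arrow a.2)
      exact ⟨⟨Over.mk p, h3, h4⟩, e, h1, h2, h5⟩)
  choose e he heX hep using hD
  let F : Rep Q A := Rep.mk (fun i => (D i).1.left) fun {j k} a =>
    Sigma.ι (fun a : Quiver.Costar k => (D a.1).1.left) ⟨j, a⟩ ≫ e k
  have hF : ∀ {j k : Q} (a : j ⟶ k), F.arrow a =
    Sigma.ι (fun a : Quiver.Costar k => (D a.1).1.left) ⟨j, a⟩ ≫ e k := fun a => Rep.mk_arrow _ _ a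
  have hphi : ∀ i, phi F i = e i := fun i => Sigma.hom_ext _ _ fun a => by
    rw [Rep.ι_phi, hF]; rfl
  let p : F ⟶ M := Rep.homMk (fun i => (D i).1.hom) fun {j k} a => by
    rw [hF]
    exact (Category.assoc _ _ _).trans ((congrArg (_ ≫ ·) (hep k)).trans (Sigma.ι_desc _ _))
  refine ⟨F, p, Rep.epi_of_appAt p fun i => (D i).2.1, fun i => ?_, fun i =>
    h.right_of_iso (D i).2.2 (Rep.kernelVal p i)⟩
  have key : ∀ f : (∐ fun a : Quiver.Costar i => (D a.1).1.left) ⟶ (D i).1.left, f = e i →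
      Mono f ∧ X (cokernel f) := by
    rintro _ rfl
    exact ⟨he i, heX i⟩
  exact key _ (hphi i)

end Phi

/-! ### Embeddings with cokernel in `Φ(X)`, and part (a). -/

section ExactCoproducts

variable {Q : Type u₁} [Quiver.{v₁} Q] {A : Type u} [Category.{v} A] [Abelian A]
  {X Y : ObjectProperty A} [∀ i : Q, HasExactCoproductsLE (Quiver.Costar i) A]

/-- Every representation embeds into a vertexwise `Y`-valued one with cokernel in `Φ(X)`. -/
theorem exists_phi_mono (hQ : IsLeftRooted Q) (h : IsCompleteCotorsionPair X Y) (M : Rep Q A) :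
    ∃ (T : Rep Q A) (t : M ⟶ T), Mono t ∧ (∀ i, Y (T.val i)) ∧ Phi Q X (cokernel t) := by
  obtain ⟨D, hD⟩ := hQ.wellFounded.exists_forall_rel
    (D := fun i => {D : Under (M.val i) // Mono D.hom ∧ Y D.right})
    (fun i x y => ∃ (e : (∐ fun a : Quiver.Costar i => (y a.1 ⟨a.2⟩).1.right) ⟶ x.1.right)
      (w : Limits.Sigma.map (fun a : Quiver.Costar i => (y a.1 ⟨a.2⟩).1.hom) ≫ e =
        phi M i ≫ x.1.hom), Mono (pushout.desc e x.1.hom w) ∧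
          X (cokernel (pushout.desc e x.1.hom w)))
    (fun i y => by
      -- Exactness of coproducts is used here: it makes `M(i)` a subobject of the pushout, hence of
      -- the new value at `i`.
      have : Mono (Limits.Sigma.map fun a : Quiver.Costar i => (y a.1 ⟨a.2⟩).1.hom) :=
        HasExactCoproductsLE.mono_map (S := Quiver.Costar i) _ le_rfl _ _ _
          fun a => (y a.1 ⟨a.2⟩).2.1
      obtain ⟨T, j, hj⟩ := h.exists_preenvelope (pushout
        (Limits.Sigma.map fun a : Quiver.Costar i => (y a.1 ⟨a.2⟩).1.hom) (phi M i))
      have := hj.mono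
      have hX := hj.cokernel_mem
      rw [h.leftPerp_eq] at hX
      have key : ∀ f, f = j → Mono f ∧ X (cokernel f) := by
        rintro _ rfl
        exact ⟨hj.mono, hX⟩
      refine ⟨⟨Under.mk (pushout.inr _ _ ≫ j), mono_comp _ _, hj.mem⟩, pushout.inl _ _ ≫ j, ?_,
        key _ ?_⟩
      · exact pushout.condition_assoc j
      · apply pushout.hom_ext
        · exact pushout.inl_desc _ _ _
        · exact pushout.inr_desc _ _ _)
  choose e w hmono hX using hD
  let T : Rep Q A := Rep.mk (fun i => (D i).1.right) fun {j k} a =>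
    Sigma.ι (fun a : Quiver.Costar k => (D a.1).1.right) ⟨j, a⟩ ≫ e k
  have hT : ∀ {j k : Q} (a : j ⟶ k), T.arrow a =
    Sigma.ι (fun a : Quiver.Costar k => (D a.1).1.right) ⟨j, a⟩ ≫ e k :=
      fun a => Rep.mk_arrow _ _ a
  have hphi : ∀ i, phi T i = e i := fun i => Sigma.hom_ext _ _ fun a => by
    rw [Rep.ι_phi, hT]; rfl
  let t : M ⟶ T := Rep.homMk (fun i => (D i).1.hom) fun {j k} a => by
    rw [hT, ← Rep.ι_phi M k ⟨j, a⟩]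
    exact (Category.assoc _ _ _).trans ((congrArg (_ ≫ ·) (w k).symm).trans
      (Sigma.ι_map_assoc _ _ _))
  have ht : Mono t := Rep.mono_of_appAt t fun i => (D i).2.1
  refine ⟨T, t, ht, fun i => (D i).2.2, fun i => ?_⟩
  have hS := Rep.shortExact_val (shortExact_cokernel t) i
  have hπ : ∀ i, Epi (Rep.appAt (cokernel.π t) i) := fun i =>
    (Rep.shortExact_val (shortExact_cokernel t) i).epi_g
  have : Epi (Limits.Sigma.map fun a : Quiver.Costar i => Rep.appAt (cokernel.π t) a.1) :=
    inferInstance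
  have hd : phi M i ≫ Rep.appAt t i =
    Limits.Sigma.map (fun a : Quiver.Costar i => Rep.appAt t a.1) ≫ phi T i := phi_appAt t i
  have key : ∀ f, f = e i → ∀ w' : Limits.Sigma.map (fun a : Quiver.Costar i => (D a.1).1.hom) ≫ f =
      phi M i ≫ (D i).1.hom, Mono (pushout.desc f (D i).1.hom w') ∧
        X (cokernel (pushout.desc f (D i).1.hom w')) := by
    rintro _ rfl w'
    exact ⟨hmono i, hX i⟩
  obtain ⟨h1, h2⟩ : Mono (pushout.desc (phi T i) (Rep.appAt t i) hd.symm) ∧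
    X (cokernel (pushout.desc (phi T i) (Rep.appAt t i) hd.symm)) := key _ (hphi i) hd.symm
  -- `φ_i` of the cokernel is a pushout of the preenvelope at `i`, so it is again mono, with
  -- isomorphic cokernel.
  have sq := isPushout_cokernel hS (IsPushout.of_hasPushout
      (Limits.Sigma.map fun a : Quiver.Costar i => Rep.appAt t a.1) (phi M i))
    (π := Limits.Sigma.map fun a : Quiver.Costar i => Rep.appAt (cokernel.π t) a.1)
    (d := pushout.desc (phi T i) (Rep.appAt t i) hd.symm) (c := phi (cokernel t) i)
    (by
      refine Sigma.hom_ext _ _ fun a => ?_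
      rw [Sigma.ι_map_assoc, Sigma.ι_map, comp_zero, comp_zero, ← Category.assoc,
        ← NatTrans.comp_app, cokernel.condition]
      exact zero_comp)
    (pushout.inr_desc _ _ _)
    (by rw [pushout.inl_desc_assoc, ← phi_appAt])
  have : IsIso (cokernel.map _ _ _ _ sq.w) := isIso_cokernel_map_of_isPushout sq
  exact ⟨(MorphismProperty.monomorphisms A).of_isPushout sq.flip
    (MorphismProperty.monomorphisms.infer_property _),
    h.left_of_iso h2 (asIso (cokernel.map _ _ _ _ sq.w)).symm⟩

/-- Vertexwise `Y`-valued representations lie in `Φ(X)^⊥`; this makes both approximations special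
and splits the cover of any object of `^⊥(Φ(X)^⊥)`. -/
theorem isCompleteCotorsionPair_phi (hQ : IsLeftRooted Q) (h : IsCompleteCotorsionPair X Y) :
    IsCompleteCotorsionPair (Phi Q X) (rightPerp (Phi Q X)) := by
  have hY : ∀ G : Rep Q A, (∀ i, Y (G.val i)) → rightPerp (Phi Q X) G := fun G hG F hF =>
    ext1Vanishes_of_phi hQ h.toIsCotorsionPair hF hG
  refine ⟨⟨rfl, ?_⟩, fun M => ?_, fun M => ?_⟩
  · refine le_antisymm (fun M hM => ?_) fun M hM N hN => hN M hM
    obtain ⟨F, p, hp, hF, hK⟩ := exists_phi_epi hQ h M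
    obtain ⟨s, hs⟩ := Ext1Vanishes.exists_section (shortExact_kernel p) (hM _ (hY _ hK))
    exact hF.of_retract h.toIsCotorsionPair s p hs
  · obtain ⟨F, p, hp, hF, hK⟩ := exists_phi_epi hQ h M
    exact ⟨F, p, hp, hF, hY _ hK⟩
  · obtain ⟨T, t, ht, hT, hC⟩ := exists_phi_mono hQ h M
    exact ⟨T, t, ht, hY _ hT, fun N hN => hN _ hC⟩

end ExactCoproducts

/-! ### The class `Ψ(Y)`: retracts, orthogonality and embeddings. -/

section Psi

variable {Q : Type u₁} [Quiver.{v₁} Q] {A : Type u} [Category.{v} A] [Abelian A]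
  {X Y : ObjectProperty A} [∀ i : Q, HasProductsLE (Quiver.Star i) A]

theorem Psi.of_retract (h : IsCotorsionPair X Y) {F G : Rep Q A} (hF : Psi Q Y F)
    (s : G ⟶ F) (r : F ⟶ G) (hsr : s ≫ r = 𝟙 G) : Psi Q Y G := by
  have hi : ∀ i, Rep.appAt s i ≫ Rep.appAt r i = 𝟙 _ := fun i => by
    rw [← NatTrans.comp_app, hsr]; rfl
  intro i
  have := (hF i).1
  constructor
  · have h1 : Epi (Limits.Pi.map fun a : Quiver.Star i => Rep.appAt r a.1) := by
      have : IsSplitEpi (Limits.Pi.map fun a : Quiver.Star i => Rep.appAt r a.1) := by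
        refine .mk' ⟨Limits.Pi.map fun a : Quiver.Star i => Rep.appAt s a.1, ?_⟩
        refine Pi.hom_ext _ _ fun a => ?_
        rw [Category.assoc, Pi.map_π, Pi.map_π_assoc, hi a.1, Category.comp_id, Category.id_comp]
      infer_instance
    have h2 : Epi (Rep.appAt r i ≫ psi G i) := by
      rw [appAt_psi]; infer_instance
    exact epi_of_epi (Rep.appAt r i) _
  · refine h.right_of_retract (hF i).2 (kernel.map _ _ _ _ (appAt_psi s i).symm)
      (kernel.map _ _ _ _ (appAt_psi r i).symm) ?_
    ext
    simp [hi i]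

/-- Vertexwise `X`-valued representations have no extensions by objects of `Ψ(Y)`. -/
theorem ext1Vanishes_of_psi (hQ : IsRightRooted Q) (h : IsCotorsionPair X Y) {F G : Rep Q A}
    (hF : ∀ i, X (F.val i)) (hG : Psi Q Y G) : Ext1Vanishes F G := by
  refine ext1Vanishes_of_splits fun {E} i p w hS => ?_
  -- Since `ψ` controls maps into `G`, the recursion builds a retraction `E ⟶ G`, converted to a
  -- section at the end.
  obtain ⟨s, hs⟩ := hQ.wellFounded.exists_forall_rel
    (D := fun j => {s : E.val j ⟶ G.val j // Rep.appAt i j ≫ s = 𝟙 _})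
    (fun i x y => ∀ a : Quiver.Star i, x.1 ≫ G.arrow a.2 = E.arrow a.2 ≫ (y a.1 ⟨a.2⟩).1)
    (fun j y => by
      have hj := Rep.shortExact_val hS j
      have : Mono (Rep.appAt i j) := hj.mono_f
      have := (hG j).1
      have hK : X (cokernel (Rep.appAt i j)) := h.left_of_iso (hF j)
        (IsColimit.coconePointUniqueUpToIso (cokernelIsCokernel _) hj.gIsCokernel)
      obtain ⟨l, hl, hl'⟩ := (h.ext1Vanishes hK (hG j).2).exists_lift (f := Rep.appAt i j)
        (g := psi G j) (u := 𝟙 _)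
        (v := Limits.Pi.lift fun a : Quiver.Star j => E.arrow a.2 ≫ (y a.1 ⟨a.2⟩).1) (by
          refine Pi.hom_ext _ _ fun a => ?_
          rw [Category.assoc, Category.assoc, Pi.lift_π, ← Category.assoc (Rep.appAt i j),
            ← Rep.arrow_appAt, Category.assoc, (y a.1 ⟨a.2⟩).2, Category.id_comp,
            Category.comp_id, Rep.psi_π])
      refine ⟨⟨l, hl⟩, fun a => ?_⟩
      rw [← Rep.psi_π, ← Category.assoc, hl', Pi.lift_π])
  let r : E ⟶ G := Rep.homMk (fun i => (s i).1) fun {j k} a => (hs j ⟨k, a⟩).symm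
  have hr : i ≫ r = 𝟙 G := Rep.hom_ext fun i => (s i).2
  let σ := ShortComplex.Splitting.ofExactOfRetraction _ hS.exact r hr hS.epi_g
  exact ⟨σ.s, σ.s_g⟩

/-- Every representation embeds into an object of `Ψ(Y)` with vertexwise `X`-valued cokernel. -/
theorem exists_psi_mono (hQ : IsRightRooted Q) (h : IsCompleteCotorsionPair X Y) (M : Rep Q A) :
    ∃ (F : Rep Q A) (t : M ⟶ F), Mono t ∧ Psi Q Y F ∧ ∀ i, X ((cokernel t).val i) := by
  obtain ⟨D, hD⟩ := hQ.wellFounded.exists_forall_rel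
    (D := fun i => {D : Under (M.val i) // Mono D.hom ∧ X (cokernel D.hom)})
    (fun i x y => ∃ e : x.1.right ⟶ (∏ᶜ fun a : Quiver.Star i => (y a.1 ⟨a.2⟩).1.right),
      Epi e ∧ Y (kernel e) ∧
        x.1.hom ≫ e = Limits.Pi.lift fun a : Quiver.Star i => M.arrow a.2 ≫ (y a.1 ⟨a.2⟩).1.hom)
    (fun i y => by
      obtain ⟨Z, t, e, h1, h2, h3, h4, h5⟩ := h.exists_factorization
        (Limits.Pi.lift fun a : Quiver.Star i => M.arrow a.2 ≫ (y a.1 ⟨a.2⟩).1.hom)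
      exact ⟨⟨Under.mk t, h1, h2⟩, e, h3, h4, h5⟩)
  choose e he heY het using hD
  let F : Rep Q A := Rep.mk (fun i => (D i).1.right) fun {j k} a =>
    e j ≫ Pi.π (fun a : Quiver.Star j => (D a.1).1.right) ⟨k, a⟩
  have hF : ∀ {j k : Q} (a : j ⟶ k), F.arrow a =
    e j ≫ Pi.π (fun a : Quiver.Star j => (D a.1).1.right) ⟨k, a⟩ := fun a => Rep.mk_arrow _ _ a
  have hpsi : ∀ i, psi F i = e i := fun i => Pi.hom_ext _ _ fun a => by
    rw [Rep.psi_π, hF]; rfl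
  let t : M ⟶ F := Rep.homMk (fun i => (D i).1.hom) fun {j k} a => by
    rw [hF]
    exact ((Category.assoc _ _ _).symm.trans
      ((congrArg (· ≫ _) (het j)).trans (Pi.lift_π _ (⟨k, a⟩ : Quiver.Star j)))).symm
  refine ⟨F, t, Rep.mono_of_appAt t fun i => (D i).2.1, fun i => ?_, fun i =>
    h.left_of_iso (D i).2.2 (Rep.cokernelVal t i)⟩
  have key : ∀ f : (D i).1.right ⟶ (∏ᶜ fun a : Quiver.Star i => (D a.1).1.right), f = e i →
      Epi f ∧ Y (kernel f) := by
    rintro _ rfl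
    exact ⟨he i, heY i⟩
  exact key _ (hpsi i)

end Psi

/-! ### Covers with kernel in `Ψ(Y)`, and part (b). -/

section ExactProducts

variable {Q : Type u₁} [Quiver.{v₁} Q] {A : Type u} [Category.{v} A] [Abelian A]
  {X Y : ObjectProperty A} [∀ i : Q, HasExactProductsLE (Quiver.Star i) A]

/-- Every representation is a quotient of a vertexwise `X`-valued one by an object of `Ψ(Y)`. -/
theorem exists_psi_epi (hQ : IsRightRooted Q) (h : IsCompleteCotorsionPair X Y) (M : Rep Q A) :
    ∃ (T : Rep Q A) (t : T ⟶ M), Epi t ∧ (∀ i, X (T.val i)) ∧ Psi Q Y (kernel t) := by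
  obtain ⟨D, hD⟩ := hQ.wellFounded.exists_forall_rel
    (D := fun i => {D : Over (M.val i) // Epi D.hom ∧ X D.left})
    (fun i x y => ∃ (e : x.1.left ⟶ ∏ᶜ fun a : Quiver.Star i => (y a.1 ⟨a.2⟩).1.left)
      (w : e ≫ Limits.Pi.map (fun a : Quiver.Star i => (y a.1 ⟨a.2⟩).1.hom) =
        x.1.hom ≫ psi M i), Epi (pullback.lift e x.1.hom w) ∧
          Y (kernel (pullback.lift e x.1.hom w)))
    (fun i y => by
      -- Exactness of products makes the projection from the pullback to `M(i)` epi.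
      have : Epi (Limits.Pi.map fun a : Quiver.Star i => (y a.1 ⟨a.2⟩).1.hom) :=
        HasExactProductsLE.epi_map (S := Quiver.Star i) _ le_rfl _ _ _
          fun a => (y a.1 ⟨a.2⟩).2.1
      obtain ⟨T, j, hj⟩ := h.exists_precover (pullback
        (Limits.Pi.map fun a : Quiver.Star i => (y a.1 ⟨a.2⟩).1.hom) (psi M i))
      have := hj.epi
      have hY := hj.kernel_mem
      rw [h.rightPerp_eq] at hY
      have key : ∀ f, f = j → Epi f ∧ Y (kernel f) := by
        rintro _ rfl
        exact ⟨hj.epi, hY⟩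
      refine ⟨⟨Over.mk (j ≫ pullback.snd _ _), epi_comp _ _, hj.mem⟩, j ≫ pullback.fst _ _, ?_,
        key _ ?_⟩
      · exact (Category.assoc _ _ _).trans ((j ≫= pullback.condition).trans
          (Category.assoc _ _ _).symm)
      · apply pullback.hom_ext
        · exact pullback.lift_fst _ _ _
        · exact pullback.lift_snd _ _ _)
  choose e w hepi hY using hD
  let T : Rep Q A := Rep.mk (fun i => (D i).1.left) fun {j k} a =>
    e j ≫ Pi.π (fun a : Quiver.Star j => (D a.1).1.left) ⟨k, a⟩
  have hT : ∀ {j k : Q} (a : j ⟶ k), T.arrow a =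
    e j ≫ Pi.π (fun a : Quiver.Star j => (D a.1).1.left) ⟨k, a⟩ := fun a => Rep.mk_arrow _ _ a
  have hpsi : ∀ i, psi T i = e i := fun i => Pi.hom_ext _ _ fun a => by
    rw [Rep.psi_π, hT]; rfl
  let t : T ⟶ M := Rep.homMk (fun i => (D i).1.hom) fun {j k} a => by
    rw [hT, ← Rep.psi_π M j ⟨k, a⟩]
    exact (Category.assoc _ _ _).trans ((congrArg (e j ≫ ·) (Pi.map_π
      (fun a : Quiver.Star j => (D a.1).1.hom) ⟨k, a⟩).symm).trans
        ((Category.assoc _ _ _).symm.trans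
          ((congrArg (· ≫ _) (w j)).trans (Category.assoc _ _ _))))
  have ht : Epi t := Rep.epi_of_appAt t fun i => (D i).2.1
  refine ⟨T, t, ht, fun i => (D i).2.2, fun i => ?_⟩
  have hS := Rep.shortExact_val (shortExact_kernel t) i
  have hκ : ∀ i, Mono (Rep.appAt (kernel.ι t) i) := fun i =>
    (Rep.shortExact_val (shortExact_kernel t) i).mono_f
  have : Mono (Limits.Pi.map fun a : Quiver.Star i => Rep.appAt (kernel.ι t) a.1) :=
    inferInstance
  have hd : Rep.appAt t i ≫ psi M i =
    psi T i ≫ Limits.Pi.map (fun a : Quiver.Star i => Rep.appAt t a.1) := appAt_psi t i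
  have key : ∀ f, f = e i → ∀ w' : f ≫ Limits.Pi.map (fun a : Quiver.Star i => (D a.1).1.hom) =
      (D i).1.hom ≫ psi M i, Epi (pullback.lift f (D i).1.hom w') ∧
        Y (kernel (pullback.lift f (D i).1.hom w')) := by
    rintro _ rfl w'
    exact ⟨hepi i, hY i⟩
  obtain ⟨h1, h2⟩ : Epi (pullback.lift (psi T i) (Rep.appAt t i) hd.symm) ∧
    Y (kernel (pullback.lift (psi T i) (Rep.appAt t i) hd.symm)) := key _ (hpsi i) hd.symm
  -- `ψ_i` of the kernel is a pullback of the precover at `i`, hence epi with isomorphic kernel.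
  have sq := isPullback_kernel hS (IsPullback.of_hasPullback
      (Limits.Pi.map fun a : Quiver.Star i => Rep.appAt t a.1) (psi M i))
    (κ := Limits.Pi.map fun a : Quiver.Star i => Rep.appAt (kernel.ι t) a.1)
    (d := pullback.lift (psi T i) (Rep.appAt t i) hd.symm) (c := psi (kernel t) i)
    (by
      refine Pi.hom_ext _ _ fun a => ?_
      rw [Category.assoc, Pi.map_π, Pi.map_π_assoc, zero_comp, zero_comp,
        ← NatTrans.comp_app, kernel.condition]
      exact comp_zero)
    (pullback.lift_snd _ _ _)
    (by rw [pullback.lift_fst, ← appAt_psi])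
  have : IsIso (kernel.map _ _ _ _ sq.flip.w) := isIso_kernel_map_of_isPullback sq.flip
  exact ⟨(MorphismProperty.epimorphisms A).of_isPullback sq
    (MorphismProperty.epimorphisms.infer_property _),
    h.right_of_iso h2 (asIso (kernel.map _ _ _ _ sq.flip.w))⟩

theorem isCompleteCotorsionPair_psi (hQ : IsRightRooted Q) (h : IsCompleteCotorsionPair X Y) :
    IsCompleteCotorsionPair (leftPerp (Psi Q Y)) (Psi Q Y) := by
  have hX : ∀ F : Rep Q A, (∀ i, X (F.val i)) → leftPerp (Psi Q Y) F := fun F hF G hG =>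
    ext1Vanishes_of_psi hQ h.toIsCotorsionPair hF hG
  refine ⟨⟨?_, rfl⟩, fun M => ?_, fun M => ?_⟩
  · refine le_antisymm (fun M hM => ?_) fun M hM N hN => hN M hM
    obtain ⟨F, t, ht, hF, hC⟩ := exists_psi_mono hQ h M
    have hS := shortExact_cokernel t
    obtain ⟨s, hs⟩ := Ext1Vanishes.exists_section hS (hM _ (hX _ hC))
    let σ := ShortComplex.Splitting.ofExactOfSection _ hS.exact s hs hS.mono_f
    exact hF.of_retract h.toIsCotorsionPair t σ.r σ.f_r
  · obtain ⟨T, t, ht, hT, hK⟩ := exists_psi_epi hQ h M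
    exact ⟨T, t, ht, hX _ hT, fun N hN => hN _ hK⟩
  · obtain ⟨F, t, ht, hF, hC⟩ := exists_psi_mono hQ h M
    exact ⟨F, t, ht, hF, hX _ hC⟩

end ExactProducts

end QuiverRep

end

theorem theoremA {A : Type u} [Category.{v} A] [Abelian A] {Q : Type u₁} [Quiver.{v₁} Q]
    (X Y : ObjectProperty A) (hXY : QuiverRep.IsCompleteCotorsionPair X Y) :
    (∀ [∀ i : Q, QuiverRep.HasExactCoproductsLE (Quiver.Costar i) A],
      QuiverRep.IsLeftRooted Q →
        QuiverRep.IsCompleteCotorsionPair (QuiverRep.Phi Q X)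
          (QuiverRep.rightPerp (QuiverRep.Phi Q X))) ∧
    (∀ [∀ i : Q, QuiverRep.HasExactProductsLE (Quiver.Star i) A],
      QuiverRep.IsRightRooted Q →
        QuiverRep.IsCompleteCotorsionPair (QuiverRep.leftPerp (QuiverRep.Psi Q Y))
          (QuiverRep.Psi Q Y)) :=
  ⟨fun hQ => QuiverRep.isCompleteCotorsionPair_phi hQ hXY,
    fun hQ => QuiverRep.isCompleteCotorsionPair_psi hQ hXY⟩
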